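/- Let $G$ be a nontrivial homogeneous group: a simply connected (in particular connected) nilpotent real Lie group, with identity $e$, equipped with dilations $(\delta_r)_{r>0}$, i.e. a continuous one-parameter group of smooth automorphisms of $G$ ($\delta_1=\mathrm{id}$, $\delta_{rs}=\delta_r\delta_s$) such that $d(\delta_r)_e=\exp(A\log r)$ on the Lie algebra, where $A$ is a diagonalizable real linear operator with positive eigenvalues. Let $\rho=\operatorname{tr}A$ be the homogeneous dimension, and let $|\cdot|:G\to[0,\infty)$ be a homogeneous norm: a continuous function with $|x|=0$ iff $x=e$, $|x^{-1}|=|x|$ and $|\delta_r x|=r|x|$ for $r>0$. Put $$\gamma=\inf\{c>0:\ |xy|\le c(|x|+|y|)\ \text{for all }x,y\in G\},\qquad B_{(x,r)}=\{y\in G:\ |x^{-1}y|<r\}.$$ Let $\lambda$ be a left Haar measure on $G$, let $L_0(G)$ be the space of classes, modulo $\lambda$-almost everywhere equality, of complex $\lambda$-measurable functions on $G$, and let $\|\cdot\|_q$ be the usual norm of $L^q(G)$, with values in $[0,\infty]$ on $L_0(G)$. For each $r>0$ fix a partition $\pi_r$ of $G$ into Borel sets such that each $E\in\pi_r$ contains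 a point $x_E$ with $x_EU_r\subset E\subset x_EU_r^2$, where $U_r=B_{(e,\,r/(4\gamma^2))}$ and $U_r^2=U_rU_r$. For $q,p,\alpha\in[1,\infty]$ and $f\in L_0(G)$ set $$\|f\|_{q,p}^{\pi_r}=\Big(\sum_{E\in\pi_r}\|f\chi_E\|_q^p\Big)^{1/p}\ (p<\infty),\qquad \|f\|_{q,\infty}^{\pi_r}=\sup_{E\in\pi_r}\|f\chi_E\|_q,$$ $$\|f\|_{q,p,\alpha}=\sup_{r>0}\lambda(B_{(e,r)})^{\frac1\alpha-\frac1q}\,\|f\|_{q,p}^{\pi_r},\qquad (L^q,L^p)^\alpha(G)=\{f\in L_0(G):\ \|f\|_{q,p,\alpha}<\infty\}.$$ **Proposition.** Let $1\le q\le p\le\infty$. Then $(L^q,L^p)^q(G)=L^q(G)$. If moreover $p<\infty$, then for every $f\in L_0(G)$ $$\|f\|_{q,p,q}\le\|f\|_q\le C\,\|f\|_{q,p,q},\qquad C=(4\gamma^4+3\gamma^2)^{\frac{\rho(p-q)}{pq}}.$$ -/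

import Mathlib

open MeasureTheory Set
open scoped ENNReal Manifold ContDiff Pointwise

/-- A family of dilations `(δ_r)_{r>0}` on a Lie group `G` modelled on `E`: a continuous
one-parameter group of smooth automorphisms whose differential at the identity, acting on the
Lie algebra `T_1 G` (which as a vector space is the model space `E`), is `exp (log r • A)` for a
diagonalizable linear operator `A` with positive eigenvalues. Only the values at `r > 0` matter. -/
structure DilationFamily (E G : Type*) [NormedAddCommGroup E] [NormedSpace ℝ E]
    [TopologicalSpace G] [ChartedSpace E G] [Group G] where
  /-- the automorphisms `δ_r` -/
  dil : ℝ → G →* G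
  /-- the operator `A` -/
  gen : E →L[ℝ] E
  gen_diagonalizable :
    ⨆ d : ℝ, Module.End.eigenspace (gen : Module.End ℝ E) d = ⊤
  gen_eigenvalue_pos :
    ∀ d : ℝ, Module.End.HasEigenvalue (gen : Module.End ℝ E) d → 0 < d
  dil_one : dil 1 = MonoidHom.id G
  dil_mul : ∀ r s : ℝ, 0 < r → 0 < s → dil (r * s) = (dil r).comp (dil s)
  dil_smooth : ∀ r : ℝ, 0 < r → ContMDiff 𝓘(ℝ, E) 𝓘(ℝ, E) ∞ (dil r)
  dil_continuous : ContinuousOn (fun z : ℝ × G => dil z.1 z.2) (Ioi 0 ×ˢ univ)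
  mfderiv_dil : ∀ r : ℝ, 0 < r → ∀ v : E,
    (mfderiv 𝓘(ℝ, E) 𝓘(ℝ, E) (dil r) (1 : G) : E → E) v
      = NormedSpace.exp (Real.log r • gen) v

namespace DilationFamily

variable {E G : Type*} [NormedAddCommGroup E] [NormedSpace ℝ E]
  [TopologicalSpace G] [ChartedSpace E G] [Group G]

/-- The homogeneous dimension: the trace of `A`, i.e. the sum of its eigenvalues counted with
multiplicity. -/
noncomputable def homogeneousDim (δ : DilationFamily E G) : ℝ :=
  LinearMap.trace ℝ E (δ.gen : E →ₗ[ℝ] E)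

end DilationFamily

/-- A homogeneous norm for the dilations `δ`. Smoothness away from the identity, which some
authors add, is not required. -/
structure HomogeneousNorm {E G : Type*} [NormedAddCommGroup E] [NormedSpace ℝ E]
    [TopologicalSpace G] [ChartedSpace E G] [Group G] (δ : DilationFamily E G) where
  /-- the function `x ↦ |x|` -/
  toFun : G → ℝ
  nonneg : ∀ x, 0 ≤ toFun x
  eq_zero_iff : ∀ x, toFun x = 0 ↔ x = 1
  inv : ∀ x, toFun x⁻¹ = toFun x
  homogeneous : ∀ r : ℝ, 0 < r → ∀ x, toFun (δ.dil r x) = r * toFun x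
  continuous : Continuous toFun

namespace HomogeneousNorm

variable {E G : Type*} [NormedAddCommGroup E] [NormedSpace ℝ E]
  [TopologicalSpace G] [ChartedSpace E G] [Group G] {δ : DilationFamily E G}

/-- `γ = inf {c > 0 : |xy| ≤ c (|x| + |y|) for all x, y}`. -/
noncomputable def quasiConst (N : HomogeneousNorm δ) : ℝ :=
  sInf {c : ℝ | 0 < c ∧ ∀ x y : G, N.toFun (x * y) ≤ c * (N.toFun x + N.toFun y)}

/-- The ball `B(x, r) = {y : |x⁻¹ y| < r}`. -/
def ball (N : HomogeneousNorm δ) (x : G) (r : ℝ) : Set G :=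
  {y | N.toFun (x⁻¹ * y) < r}

end HomogeneousNorm

/-- `π` is a `U`-`V` uniform partition of `G`: a partition of `G` into Borel sets such that each
member `E` contains a point `x` with `x U ⊆ E ⊆ x V`. (The conditions customarily put on the pair
`U`, `V` alone -- relatively compact open neighbourhoods of the identity with the closure of `U`
inside `V` -- are not repeated here.) -/
structure IsUniformPartition {G : Type*} [Group G] [MeasurableSpace G]
    (U V : Set G) (π : Set (Set G)) : Prop where
  isPartition : Setoid.IsPartition π
  measurableSet : ∀ E ∈ π, MeasurableSet E
  exists_center : ∀ E ∈ π, ∃ x ∈ E, x • U ⊆ E ∧ E ⊆ x • V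

/-- `‖f‖_{q,p}^π`: the `ℓ^p(π)` norm of the family `(‖f χ_E‖_q)_{E ∈ π}`. -/
noncomputable def amalgamNorm {G : Type*} [MeasurableSpace G] (μ : Measure G)
    (q p : ℝ≥0∞) (π : Set (Set G)) (f : G → ℂ) : ℝ≥0∞ :=
  if p = ⊤ then ⨆ E ∈ π, eLpNorm (E.indicator f) q μ
  else (∑' E : π, eLpNorm ((E : Set G).indicator f) q μ ^ p.toReal) ^ (1 / p.toReal)

section FractionalAmalgam

variable {E G : Type*} [NormedAddCommGroup E] [NormedSpace ℝ E]
  [TopologicalSpace G] [ChartedSpace E G] [Group G] {δ : DilationFamily E G}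

/-- `π r`, for each `r > 0`, is a `B(e, r/(4γ²))`-`B(e, r/(4γ²))²` uniform partition of `G`. -/
def IsScaledPartitionFamily [MeasurableSpace G] (N : HomogeneousNorm δ)
    (π : ℝ → Set (Set G)) : Prop :=
  ∀ r : ℝ, 0 < r →
    IsUniformPartition (N.ball 1 (r / (4 * N.quasiConst ^ 2)))
      (N.ball 1 (r / (4 * N.quasiConst ^ 2)) * N.ball 1 (r / (4 * N.quasiConst ^ 2))) (π r)

/-- `‖f‖_{q,p,α} = sup_{r>0} λ(B(e,r))^{1/α - 1/q} ‖f‖_{q,p}^{π_r}` (with `1/∞ = 0`). -/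
noncomputable def fracAmalgamNorm [MeasurableSpace G] (N : HomogeneousNorm δ) (μ : Measure G)
    (π : ℝ → Set (Set G)) (q p α : ℝ≥0∞) (f : G → ℂ) : ℝ≥0∞ :=
  ⨆ (r : ℝ) (_ : 0 < r),
    μ (N.ball 1 r) ^ ((α⁻¹).toReal - (q⁻¹).toReal) * amalgamNorm μ q p (π r) f

/-- The space `(L^q, L^p)^α(G)`, as a set of classes of `μ`-measurable complex functions modulo
equality almost everywhere. -/
def fracAmalgamSpace [MeasurableSpace G] (N : HomogeneousNorm δ) (μ : Measure G)
    (π : ℝ → Set (Set G)) (q p α : ℝ≥0∞) : Set (G →ₘ[μ] ℂ) :=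
  {f | fracAmalgamNorm N μ π q p α f < ⊤}

end FractionalAmalgam

/-! For `α = q` the factor `λ(B(e,r)) ^ (1/α - 1/q)` is 1, so the norm is the supremum over `r` of
the amalgam norms for `π r`. The `ℓ^q` norm of the pieces `‖f χ_E‖_q` is `‖f‖_q` when `q < ∞`, and
`ℓ^p` norms decrease in `p`; this gives the first inequality.

Conversely, put `k = 4γ⁴ + 3γ²` and take `r = 4γ²R`, so that `U_r = B(e,R)`. The members of `π r`
meeting this ball contain disjoint translates of it, all inside `B(e,kR)`, whose measure is at most
`k^ρ λ(B(e,R))`. Hence at most `k^ρ` members meet the ball (`card_le_of_inter_ball_nonempty`), and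
Hölder's inequality bounds `‖f χ_{B(e,R)}‖_q` with the constant `(k^ρ)^(1/q - 1/p)`. It does not
depend on `R`, so `R → ∞` finishes. For `q = ∞` a single countable partition suffices.

Two facts about `G` are needed. Closed balls are compact (`isCompact_setOf_le`), because small
dilations contract; hence `γ` is a genuine constant and balls have finite measure. And `δ_r`
multiplies Haar measure by at most `r^ρ` (`measure_image_dil_le`): a chart gives this up to a
constant independent of `r`, and iterating the dilation removes the constant. -/

open Filter Topology

/-! ### Diagonalizable operators and their exponentials. -/

section Diagonalizable

variable {E : Type*} [NormedAddCommGroup E] [NormedSpace ℝ E]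

theorem Module.End.exists_basis_eigenvectors_of_iSup_eigenspace_eq_top
    {K V : Type*} [Field K] [AddCommGroup V] [Module K V] [FiniteDimensional K V]
    (T : Module.End K V) (hT : ⨆ d : K, Module.End.eigenspace T d = ⊤) :
    ∃ (b : Module.Basis (Fin (Module.finrank K V)) K V) (d : Fin (Module.finrank K V) → K),
      ∀ i, T (b i) = d i • b i := by
  have hs : ⊤ ≤ Submodule.span K {v : V | ∃ d : K, T v = d • v} := by
    rw [← hT]
    refine iSup_le fun d v hv => Submodule.subset_span ⟨d, ?_⟩
    exact Module.End.mem_eigenspace_iff.1 hv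
  let b₀ := Module.Basis.ofSpan hs
  let b := b₀.reindex (b₀.indexEquiv (Module.finBasis K V))
  have h : ∀ i, ∃ d : K, T (b i) = d • b i := by
    intro i
    have : b i ∈ {v : V | ∃ d : K, T v = d • v} := by
      rw [Module.Basis.reindex_apply]
      exact Module.Basis.ofSpan_subset hs (mem_range_self _)
    exact this
  choose d hd using h
  exact ⟨b, d, hd⟩

theorem ContinuousLinearMap.exp_smul_apply_of_eigenvector [CompleteSpace E] (A : E →L[ℝ] E)
    (t d : ℝ) (v : E) (h : A v = d • v) :
    NormedSpace.exp (t • A) v = Real.exp (t * d) • v := by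
  have h1 := NormedSpace.exp_series_hasSum_exp' (𝕂 := ℝ) (t • A)
  have h2 := (ContinuousLinearMap.apply ℝ E v).hasSum h1
  have h3 := (NormedSpace.exp_series_hasSum_exp' (𝕂 := ℝ) (t * d)).smul_const v
  have h4 : ∀ n : ℕ, ((t • A) ^ n) v = (t * d) ^ n • v := by
    intro n
    induction n with
    | zero => simp
    | succ n ih =>
      rw [pow_succ, mul_apply_eq_comp, smul_apply, h, smul_smul,
        map_smul, ih, smul_smul, pow_succ, mul_comm]
  rw [Real.exp_eq_exp_ℝ]
  refine h2.unique ?_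
  convert h3 using 2 with n
  simp [h4, smul_smul]

end Diagonalizable

namespace DilationFamily

variable {E G : Type*} [NormedAddCommGroup E] [NormedSpace ℝ E] [FiniteDimensional ℝ E]
  [TopologicalSpace G] [ChartedSpace E G] [Group G]

theorem exists_basis_eigenvectors (δ : DilationFamily E G) :
    ∃ (b : Module.Basis (Fin (Module.finrank ℝ E)) ℝ E) (d : Fin (Module.finrank ℝ E) → ℝ),
      (∀ i, δ.gen (b i) = d i • b i) ∧ ∀ i, 0 < d i := by
  obtain ⟨b, d, h⟩ :=
    Module.End.exists_basis_eigenvectors_of_iSup_eigenspace_eq_top _ δ.gen_diagonalizable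
  exact ⟨b, d, h, fun i => δ.gen_eigenvalue_pos _
    (Module.End.hasEigenvalue_of_hasEigenvector
      ⟨Module.End.mem_eigenspace_iff.2 (h i), b.ne_zero i⟩)⟩

/-- In an eigenbasis the exponential is diagonal with entries `r ^ d i`; their product has exponent
`tr A`. -/
theorem det_exp_log_smul_gen (δ : DilationFamily E G) {r : ℝ} (hr : 0 < r) :
    (NormedSpace.exp (Real.log r • δ.gen)).det = r ^ δ.homogeneousDim := by
  have := FiniteDimensional.complete ℝ E
  obtain ⟨b, d, h, -⟩ := δ.exists_basis_eigenvectors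
  have h1 : LinearMap.toMatrix b b (δ.gen : E →ₗ[ℝ] E) = Matrix.diagonal d := by
    ext i j
    rw [LinearMap.toMatrix_apply]
    simp only [ContinuousLinearMap.coe_coe, h, map_smul, Module.Basis.repr_self, Finsupp.smul_apply,
      Matrix.diagonal_apply, Finsupp.single_apply]
    by_cases hij : i = j
    · simp [hij]
    · simp [hij, Ne.symm hij]
  have h2 : LinearMap.toMatrix b b
      ((NormedSpace.exp (Real.log r • δ.gen) : E →L[ℝ] E) : E →ₗ[ℝ] E)
      = Matrix.diagonal fun i => r ^ d i := by
    ext i j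
    rw [LinearMap.toMatrix_apply]
    simp only [ContinuousLinearMap.coe_coe,
      ContinuousLinearMap.exp_smul_apply_of_eigenvector _ _ _ _ (h _),
      map_smul, Module.Basis.repr_self, Finsupp.smul_apply,
      Matrix.diagonal_apply, Finsupp.single_apply, Real.rpow_def_of_pos hr]
    by_cases hij : i = j
    · simp [hij]
    · simp [hij, Ne.symm hij]
  rw [ContinuousLinearMap.det, ← LinearMap.det_toMatrix b, h2, Matrix.det_diagonal,
    homogeneousDim, LinearMap.trace_eq_matrix_trace ℝ b, h1, Matrix.trace_diagonal,
    Real.rpow_sum_of_pos hr]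

/-- Since every `d i` is positive, `r ^ d i → 0` as `r → 0⁺`; smallness on an eigenbasis controls
the operator norm. -/
theorem exists_norm_exp_log_smul_gen_lt (δ : DilationFamily E G) {ε : ℝ} (hε : 0 < ε) :
    ∃ r : ℝ, 0 < r ∧ r < 1 ∧ ‖NormedSpace.exp (Real.log r • δ.gen)‖ < ε := by
  have := FiniteDimensional.complete ℝ E
  obtain ⟨b, d, h, hd⟩ := δ.exists_basis_eigenvectors
  obtain ⟨C, hC, hop⟩ := b.exists_opNorm_le (F := E)
  have key : ∀ᶠ r : ℝ in 𝓝[>] 0, ∀ i,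
      ‖NormedSpace.exp (Real.log r • δ.gen) (b i)‖ < ε / (2 * C) := by
    rw [eventually_all]
    intro i
    have h1 : Tendsto (fun r : ℝ => r ^ d i * ‖b i‖) (𝓝[>] 0) (𝓝 (0 * ‖b i‖)) := by
      refine Tendsto.mul_const _ ?_
      have := (Real.continuousAt_rpow_const 0 (d i) (Or.inr (hd i).le)).tendsto
      rw [Real.zero_rpow (hd i).ne'] at this
      exact this.mono_left nhdsWithin_le_nhds
    rw [zero_mul] at h1
    filter_upwards [h1.eventually (gt_mem_nhds (show 0 < ε / (2 * C) by positivity)),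
      self_mem_nhdsWithin] with r hr hr0
    rw [ContinuousLinearMap.exp_smul_apply_of_eigenvector _ _ _ _ (h i), norm_smul,
      ← Real.rpow_def_of_pos hr0, Real.norm_of_nonneg (Real.rpow_nonneg (le_of_lt hr0) _)]
    exact hr
  obtain ⟨r, hr, hr0, hr1⟩ := (key.and (Ioo_mem_nhdsGT zero_lt_one)).exists
  refine ⟨r, hr0, hr1, (hop (M := ε / (2 * C)) (by positivity) fun i => (hr i).le).trans_lt ?_⟩
  have : C * (ε / (2 * C)) = ε / 2 := by field_simp
  rw [this]; linarith

end DilationFamily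

/-! ### Multiplication and dilations in the chart at the identity. -/

section Chart

variable {E G : Type*} [NormedAddCommGroup E] [NormedSpace ℝ E]
  [TopologicalSpace G] [ChartedSpace E G] [Group G] [LieGroup 𝓘(ℝ, E) ∞ G]

/-- In the chart at the identity of a Lie group, multiplication is of class `C^1` at the
identity. -/
theorem LieGroup.contDiffAt_mul_in_chart :
    ContDiffAt ℝ 1 (fun z : E × E => chartAt E (1 : G)
      ((chartAt E (1 : G)).symm z.1 * (chartAt E (1 : G)).symm z.2))
      (chartAt E (1 : G) 1, chartAt E (1 : G) 1) := by
  set φ := chartAt E (1 : G) with hφ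
  have ha : φ 1 ∈ φ.target := φ.map_source (mem_chart_source E 1)
  have h1 : ContMDiffAt 𝓘(ℝ, E) 𝓘(ℝ, E) ∞ φ.symm (φ 1) :=
    contMDiffOn_chart_symm.contMDiffAt (φ.open_target.mem_nhds ha)
  have h2 : ContMDiffAt 𝓘(ℝ, E) 𝓘(ℝ, E) ∞ φ (φ.symm (φ 1) * φ.symm (φ 1)) := by
    rw [φ.left_inv (mem_chart_source E 1), mul_one]
    exact contMDiffAt_of_mem_maximalAtlas (IsManifold.chart_mem_maximalAtlas 1)
      (mem_chart_source E 1)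
  have h3 : ContMDiffAt 𝓘(ℝ, E × E) 𝓘(ℝ, E) ∞ (fun z : E × E => φ (φ.symm z.1 * φ.symm z.2))
      (φ 1, φ 1) := by
    have hf : ContMDiffAt 𝓘(ℝ, E × E) 𝓘(ℝ, E) ∞ (fun z : E × E => φ.symm z.1) (φ 1, φ 1) :=
      ContMDiffAt.comp (I' := 𝓘(ℝ, E)) (φ 1, φ 1) h1 contDiffAt_fst.contMDiffAt
    have hs : ContMDiffAt 𝓘(ℝ, E × E) 𝓘(ℝ, E) ∞ (fun z : E × E => φ.symm z.2) (φ 1, φ 1) :=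
      ContMDiffAt.comp (I' := 𝓘(ℝ, E)) (φ 1, φ 1) h1 contDiffAt_snd.contMDiffAt
    exact ContMDiffAt.comp (I' := 𝓘(ℝ, E)) (φ 1, φ 1) h2 (hf.mul hs)
  exact h3.contDiffAt.of_le (by norm_cast)

/-- Right translations by elements near the identity are uniformly Lipschitz in the chart at the
identity. -/
theorem LieGroup.exists_lipschitzOnWith_mul_right_in_chart :
    ∃ K : NNReal, ∃ V ∈ 𝓝 (chartAt E (1 : G) 1), ∃ H ∈ 𝓝 (1 : G), ∀ h ∈ H,
      LipschitzOnWith K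
        (fun x : E => chartAt E (1 : G) ((chartAt E (1 : G)).symm x * h)) V := by
  obtain ⟨K, t, ht, hK⟩ := (LieGroup.contDiffAt_mul_in_chart (E := E) (G := G)).exists_lipschitzOnWith
  set φ := chartAt E (1 : G) with hφ
  rw [nhds_prod_eq] at ht
  obtain ⟨V, hV, W, hW, hVW⟩ := mem_prod_iff.1 ht
  have h1 : (1 : G) ∈ φ.source := mem_chart_source E 1
  refine ⟨K, V, hV, φ.source ∩ φ ⁻¹' W, inter_mem (φ.open_source.mem_nhds h1)
    (φ.continuousAt h1 hW), fun h hh x hx y hy => ?_⟩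
  have := hK (x := (x, φ h)) (hVW ⟨hx, hh.2⟩) (y := (y, φ h)) (hVW ⟨hy, hh.2⟩)
  simpa [φ.left_inv hh.1, Prod.edist_eq] using this

end Chart

namespace DilationFamily

variable {E G : Type*} [NormedAddCommGroup E] [NormedSpace ℝ E]
  [TopologicalSpace G] [ChartedSpace E G] [Group G] [LieGroup 𝓘(ℝ, E) ∞ G]

/-- `δ_r`, read in the chart at the identity, is strictly differentiable at the identity with
derivative `exp (log r • A)`. -/
theorem hasStrictFDerivAt_in_chart (δ : DilationFamily E G) {r : ℝ} (hr : 0 < r) :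
    HasStrictFDerivAt (fun x : E => chartAt E (1 : G) (δ.dil r ((chartAt E (1 : G)).symm x)))
      (NormedSpace.exp (Real.log r • δ.gen)) (chartAt E (1 : G) 1) := by
  set φ := chartAt E (1 : G) with hφ
  have ha : φ 1 ∈ φ.target := φ.map_source (mem_chart_source E 1)
  have h1 : ContMDiffAt 𝓘(ℝ, E) 𝓘(ℝ, E) ∞ φ.symm (φ 1) :=
    contMDiffOn_chart_symm.contMDiffAt (φ.open_target.mem_nhds ha)
  have h2 : ContMDiffAt 𝓘(ℝ, E) 𝓘(ℝ, E) ∞ φ (δ.dil r (φ.symm (φ 1))) := by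
    rw [φ.left_inv (mem_chart_source E 1), map_one]
    exact contMDiffAt_of_mem_maximalAtlas (IsManifold.chart_mem_maximalAtlas 1)
      (mem_chart_source E 1)
  have h3 : ContDiffAt ℝ 1 (fun x : E => φ (δ.dil r (φ.symm x))) (φ 1) := by
    have : ContMDiffAt 𝓘(ℝ, E) 𝓘(ℝ, E) ∞ (fun x : E => φ (δ.dil r (φ.symm x))) (φ 1) :=
      ContMDiffAt.comp (φ 1) h2 (ContMDiffAt.comp (φ 1) ((δ.dil_smooth r hr).contMDiffAt) h1)
    exact this.contDiffAt.of_le (by norm_cast)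
  have h4 := h3.hasStrictFDerivAt one_ne_zero
  have h5 : fderiv ℝ (fun x : E => φ (δ.dil r (φ.symm x))) (φ 1)
      = NormedSpace.exp (Real.log r • δ.gen) := by
    ext v
    rw [← δ.mfderiv_dil r hr v]
    have hd : MDifferentiableAt 𝓘(ℝ, E) 𝓘(ℝ, E) (δ.dil r) 1 :=
      (δ.dil_smooth r hr).contMDiffAt.mdifferentiableAt (by simp)
    -- The manifold derivative is the derivative of the map read in the charts at `1` and at `δ_r 1
    -- = 1`, which are the same chart.
    have e : (mfderiv 𝓘(ℝ, E) 𝓘(ℝ, E) (δ.dil r) (1 : G) : E → E) v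
        = fderivWithin ℝ (writtenInExtChartAt 𝓘(ℝ, E) 𝓘(ℝ, E) (1 : G) (δ.dil r))
            (range 𝓘(ℝ, E)) (extChartAt 𝓘(ℝ, E) (1 : G) 1) v :=
      DFunLike.congr_fun hd.mfderiv v
    rw [e]
    simp [writtenInExtChartAt, Function.comp_def, hφ, map_one]
  rwa [h5] at h4

end DilationFamily

/-! ### Haar measure against Lebesgue measure near the identity. -/

section Comparison

variable {E G : Type*} [NormedAddCommGroup E] [NormedSpace ℝ E] [FiniteDimensional ℝ E]
  [MeasurableSpace E] [BorelSpace E]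
  [TopologicalSpace G] [SigmaCompactSpace G] [ChartedSpace E G] [Group G]
  [LieGroup 𝓘(ℝ, E) ∞ G] [MeasurableSpace G] [BorelSpace G]

/-- In the chart at the identity of a Lie group, a left Haar measure and the Hausdorff (that is, a
Lebesgue) measure of the model space are comparable near the identity. -/
theorem LieGroup.exists_haar_comparable_in_chart (μ : Measure G) [μ.IsHaarMeasure] :
    ∃ C : ℝ≥0∞, C ≠ ⊤ ∧ ∃ V ∈ 𝓝 (chartAt E (1 : G) 1), V ⊆ (chartAt E (1 : G)).target ∧
      ∀ T ⊆ V, IsOpen T →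
        μ ((chartAt E (1 : G)).symm '' T) ≤ C * Measure.hausdorffMeasure (Module.finrank ℝ E) T ∧
        Measure.hausdorffMeasure (Module.finrank ℝ E) T ≤
          C * μ ((chartAt E (1 : G)).symm '' T) := by
  have : ProperSpace E := FiniteDimensional.proper ℝ E
  have : LocallyCompactSpace G := Manifold.locallyCompact_of_finiteDimensional (M := G) 𝓘(ℝ, E)
  have : IsTopologicalGroup G := topologicalGroup_of_lieGroup 𝓘(ℝ, E) ∞
  have : SecondCountableTopology G := ChartedSpace.secondCountable_of_sigmaCompact E G
  obtain ⟨K, V₁, hV₁, H, hH, hlip⟩ :=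
    LieGroup.exists_lipschitzOnWith_mul_right_in_chart (E := E) (G := G)
  set φ := chartAt E (1 : G) with hφ
  set m : Measure E := Measure.hausdorffMeasure (Module.finrank ℝ E) with hm
  have h1 : (1 : G) ∈ φ.source := mem_chart_source E 1
  have ha : φ 1 ∈ φ.target := φ.map_source h1
  have hψ : ContinuousAt φ.symm (φ 1) := φ.symm.continuousAt ha
  have hψ1 : φ.symm (φ 1) = 1 := φ.left_inv h1
  obtain ⟨Q, hQ, hQ1⟩ := exists_compact_mem_nhds (1 : G)
  -- Both `g` and `g⁻¹` must translate in a Lipschitz way, hence `H ∩ H⁻¹`; the compact `Q` makes `μ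
  -- H'` finite.
  set H' : Set G := interior (H ∩ H⁻¹ ∩ Q) with hH'
  have hH'1 : H' ∈ 𝓝 (1 : G) := by
    refine interior_mem_nhds.2 (inter_mem (inter_mem hH ?_) hQ1)
    exact inv_mem_nhds_one G hH
  have hH'H : ∀ g ∈ H', g ∈ H ∧ g⁻¹ ∈ H := fun g hg => (interior_subset hg).1
  have hH'fin : μ H' ≠ ⊤ :=
    ((measure_mono (interior_subset.trans inter_subset_right)).trans_lt hQ.measure_lt_top).ne
  have hcont : ContinuousAt (fun z : E × E => (φ.symm z.1)⁻¹ * φ.symm z.2) (φ 1, φ 1) :=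
    ((ContinuousAt.comp (x := (φ 1, φ 1)) hψ continuousAt_fst).inv).mul
      (ContinuousAt.comp (x := (φ 1, φ 1)) hψ continuousAt_snd)
  have hnear : (fun z : E × E => (φ.symm z.1)⁻¹ * φ.symm z.2) ⁻¹' H' ∈ 𝓝 (φ 1, φ 1) :=
    hcont (by simpa [hψ1] using hH'1)
  rw [nhds_prod_eq] at hnear
  obtain ⟨W₀, hW₀, V₀, hV₀, hWV⟩ := mem_prod_iff.1 hnear
  set W : Set E := interior (W₀ ∩ V₀ ∩ V₁ ∩ Metric.ball (φ 1) 1 ∩ φ.target) with hW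
  have hWsub : W ⊆ W₀ ∩ V₀ ∩ V₁ ∩ Metric.ball (φ 1) 1 ∩ φ.target := interior_subset
  have hWo : IsOpen W := isOpen_interior
  have hWa : W ∈ 𝓝 (φ 1) := interior_mem_nhds.2 (inter_mem (inter_mem (inter_mem
    (inter_mem hW₀ hV₀) hV₁) (Metric.ball_mem_nhds _ one_pos)) (φ.open_target.mem_nhds ha))
  have hWfin : m W ≠ ⊤ :=
    ((measure_mono fun x hx => (hWsub hx).1.2).trans_lt Metric.isBounded_ball.measure_lt_top).ne
  have hWpos : m W ≠ 0 := (Measure.measure_pos_of_mem_nhds m hWa).ne'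
  have hcont2 : ContinuousAt (fun z : E × G => φ.symm z.1 * z.2⁻¹) (φ 1, 1) :=
    (ContinuousAt.comp (x := (φ 1, (1 : G))) hψ continuousAt_fst).mul continuousAt_snd.inv
  have hnear2 : (fun z : E × G => φ.symm z.1 * z.2⁻¹) ⁻¹' (φ.source ∩ φ ⁻¹' W) ∈ 𝓝 (φ 1, (1 : G)) :=
    hcont2 (by
      simpa [hψ1] using inter_mem (φ.open_source.mem_nhds h1) (φ.continuousAt h1 hWa))
  rw [nhds_prod_eq] at hnear2
  obtain ⟨V₂, hV₂, H₂, hH₂, hVH⟩ := mem_prod_iff.1 hnear2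
  set H₃ : Set G := interior (H₂ ∩ H') with hH₃
  have hH₃1 : H₃ ∈ 𝓝 (1 : G) := interior_mem_nhds.2 (inter_mem hH₂ hH'1)
  have hH₃pos : μ H₃ ≠ 0 := (Measure.measure_pos_of_mem_nhds μ hH₃1).ne'
  have hH₃fin : μ H₃ ≠ ⊤ :=
    ((measure_mono (interior_subset.trans inter_subset_right)).trans_lt hH'fin.lt_top).ne
  set k : ℝ≥0∞ := (K : ℝ≥0∞) ^ (Module.finrank ℝ E : ℝ) with hk
  have hkfin : k ≠ ⊤ := ENNReal.rpow_ne_top_of_nonneg (by positivity) ENNReal.coe_ne_top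
  refine ⟨max (k * μ H' / m W) (k * m W / μ H₃), ?_, W ∩ V₂, inter_mem hWa hV₂,
    fun x hx => (hWsub hx.1).2, fun T hT hTo => ?_⟩
  · exact (max_lt (ENNReal.div_lt_top (ENNReal.mul_ne_top hkfin hH'fin) hWpos)
      (ENNReal.div_lt_top (ENNReal.mul_ne_top hkfin hWfin) hH₃pos)).ne
  have hTt : T ⊆ φ.target := fun x hx => (hWsub (hT hx).1).2
  set S : Set G := φ.symm '' T with hS
  have hSo : IsOpen S := φ.symm.isOpen_image_of_subset_source hTo hTt
  -- The product measure of `Z` is computed in two ways. Slices at fixed `x` are left translates of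
  -- `S`, of measure `μ S`; slices at fixed `g` are, in the chart, right translates of `T`, so the
  -- Lipschitz bound compares them with `m T`.
  set Z : Set (E × G) := (W ×ˢ univ) ∩ (fun z : E × G => φ.symm z.1 * z.2) ⁻¹' S with hZ
  have hZo : IsOpen Z := by
    refine ContinuousOn.isOpen_inter_preimage ?_ (hWo.prod isOpen_univ) hSo
    refine ContinuousOn.mul (φ.continuousOn_symm.comp continuousOn_fst ?_) continuousOn_snd
    exact fun z hz => (hWsub hz.1).2
  have hF1 : (m.prod μ) Z = m W * μ S := by
    rw [Measure.prod_apply hZo.measurableSet]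
    have : ∀ x, μ (Prod.mk x ⁻¹' Z) = W.indicator (fun _ => μ S) x := by
      intro x
      by_cases hx : x ∈ W
      · rw [indicator_of_mem hx, ← measure_preimage_mul μ (φ.symm x) S]
        congr 1
        ext g
        simp [hZ, hx]
      · rw [indicator_of_notMem hx]
        simp [hZ, hx]
    simp_rw [this]
    rw [lintegral_indicator_const hWo.measurableSet, mul_comm]
  have hF2 : (m.prod μ) Z = ∫⁻ g, m ((fun x => (x, g)) ⁻¹' Z) ∂μ :=
    Measure.prod_apply_symm hZo.measurableSet
  constructor
  -- For `g ∈ H'` the slice lies in the image of `T` under translation by `g⁻¹`; for other `g` it is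
  -- empty, by the choice of `W₀` and `V₀`.
  · have hle : m W * μ S ≤ k * m T * μ H' := by
      rw [← hF1, hF2, ← lintegral_indicator_const isOpen_interior.measurableSet]
      refine lintegral_mono fun g => ?_
      by_cases hg : g ∈ H'
      · rw [indicator_of_mem hg]
        refine (measure_mono ?_).trans
          (((hlip g⁻¹ (hH'H g hg).2).mono (s := T)
            fun x hx => (hWsub (hT hx).1).1.1.2).hausdorffMeasure_image_le (by positivity))
        rintro x ⟨⟨hxW, -⟩, y, hy, hxy⟩
        refine ⟨y, hy, ?_⟩
        simp only at hxy ⊢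
        rw [hxy, mul_inv_cancel_right]
        exact φ.right_inv (hWsub hxW).2
      · rw [indicator_of_notMem hg, nonpos_iff_eq_zero]
        refine measure_mono_null (t := ∅) ?_ measure_empty
        rintro x ⟨⟨hxW, -⟩, y, hy, hxy⟩
        refine hg ?_
        have := hWV (show (x, y) ∈ W₀ ×ˢ V₀ from
          ⟨(hWsub hxW).1.1.1.1, (hWsub (hT hy).1).1.1.1.2⟩)
        simp only [mem_preimage] at this
        simp only at hxy
        rwa [hxy, inv_mul_cancel_left] at this
    refine le_trans ?_ (mul_le_mul_left (le_max_left _ _) _)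
    rw [← ENNReal.mul_div_right_comm, ENNReal.le_div_iff_mul_le (Or.inl hWpos) (Or.inl hWfin)]
    calc μ S * m W = m W * μ S := mul_comm _ _
      _ ≤ k * m T * μ H' := hle
      _ = k * μ H' * m T := by ring
  -- For `g ∈ H₃` translation by `g` maps the slice onto a set containing `T`: the choice of `V₂`
  -- and `H₂` keeps `φ.symm y * g⁻¹` inside the chart image of `W`.
  · have hle : m T * μ H₃ ≤ k * (m W * μ S) := by
      rw [← hF1, hF2, ← lintegral_indicator_const isOpen_interior.measurableSet,
        ← lintegral_const_mul' _ _ hkfin]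
      refine lintegral_mono fun g => ?_
      by_cases hg : g ∈ H₃
      · rw [indicator_of_mem hg]
        have hg' := interior_subset hg
        refine (measure_mono ?_).trans
          (((hlip g (hH'H g hg'.2).1).mono (s := (fun x => (x, g)) ⁻¹' Z)
            fun x hx => (hWsub hx.1.1).1.1.2).hausdorffMeasure_image_le (by positivity))
        intro y hy
        have hyg := hVH (show (y, g) ∈ V₂ ×ˢ H₂ from ⟨(hT hy).2, hg'.1⟩)
        have h2 : φ.symm (φ (φ.symm y * g⁻¹)) = φ.symm y * g⁻¹ := φ.left_inv hyg.1
        refine ⟨φ (φ.symm y * g⁻¹), ⟨⟨hyg.2, mem_univ _⟩, y, hy, ?_⟩, ?_⟩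
        · simp [h2]
        · simp only [h2, inv_mul_cancel_right]
          exact φ.right_inv (hTt hy)
      · rw [indicator_of_notMem hg]
        exact zero_le
    refine le_trans ?_ (mul_le_mul_left (le_max_right _ _) _)
    rw [← ENNReal.mul_div_right_comm, ENNReal.le_div_iff_mul_le (Or.inl hH₃pos) (Or.inl hH₃fin)]
    exact hle.trans_eq (by ring)

end Comparison

/-! ### The effect of dilations on Haar measure. -/

namespace DilationFamily

section Basic

variable {E G : Type*} [NormedAddCommGroup E] [NormedSpace ℝ E]
  [TopologicalSpace G] [ChartedSpace E G] [Group G]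

theorem dil_dil_inv (δ : DilationFamily E G) {r : ℝ} (hr : 0 < r) (x : G) :
    δ.dil r (δ.dil r⁻¹ x) = x := by
  have := δ.dil_mul r r⁻¹ hr (inv_pos.2 hr)
  rw [mul_inv_cancel₀ hr.ne', δ.dil_one] at this
  exact (DFunLike.congr_fun this x).symm

theorem dil_inv_dil (δ : DilationFamily E G) {r : ℝ} (hr : 0 < r) (x : G) :
    δ.dil r⁻¹ (δ.dil r x) = x := by
  simpa using δ.dil_dil_inv (inv_pos.2 hr) x

theorem continuous_dil (δ : DilationFamily E G) {r : ℝ} (hr : 0 < r) : Continuous (δ.dil r) :=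
  (δ.dil_smooth r hr).continuous

theorem dil_pow_succ_apply (δ : DilationFamily E G) {r : ℝ} (hr : 0 < r) (n : ℕ) (x : G) :
    δ.dil (r ^ (n + 1)) x = δ.dil r (δ.dil (r ^ n) x) := by
  rw [pow_succ', δ.dil_mul r _ hr (pow_pos hr n)]
  rfl

/-- The dilation `δ_r` as an automorphism of the topological group `G`. -/
noncomputable def dilEquiv (δ : DilationFamily E G) (r : ℝ) (hr : 0 < r) : G ≃ₜ* G where
  toFun := δ.dil r
  invFun := δ.dil r⁻¹
  left_inv := δ.dil_inv_dil hr
  right_inv := δ.dil_dil_inv hr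
  map_mul' := map_mul _
  continuous_toFun := δ.continuous_dil hr
  continuous_invFun := δ.continuous_dil (inv_pos.2 hr)

theorem coe_dilEquiv (δ : DilationFamily E G) (r : ℝ) (hr : 0 < r) :
    ⇑(δ.dilEquiv r hr) = δ.dil r := rfl

theorem isOpenMap_dil (δ : DilationFamily E G) {r : ℝ} (hr : 0 < r) : IsOpenMap (δ.dil r) :=
  (δ.dilEquiv r hr).toHomeomorph.isOpenMap

end Basic

section Measure

variable {E G : Type*} [NormedAddCommGroup E] [NormedSpace ℝ E] [FiniteDimensional ℝ E]
  [TopologicalSpace G] [SigmaCompactSpace G] [ChartedSpace E G] [Group G]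
  [LieGroup 𝓘(ℝ, E) ∞ G] [MeasurableSpace G] [BorelSpace G]

/-- By uniqueness of Haar measure an automorphism scales it by a constant, and constants multiply
under iteration. -/
theorem exists_measure_image_dil_eq (δ : DilationFamily E G) (μ : Measure G) [μ.IsHaarMeasure]
    {r : ℝ} (hr : 0 < r) :
    ∃ J : NNReal, (∀ S : Set G, μ (δ.dil r '' S) = J * μ S) ∧
      ∀ (n : ℕ) (S : Set G), μ (δ.dil (r ^ n) '' S) = (J : ℝ≥0∞) ^ n * μ S := by
  have : LocallyCompactSpace G := Manifold.locallyCompact_of_finiteDimensional (M := G) 𝓘(ℝ, E)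
  have : IsTopologicalGroup G := topologicalGroup_of_lieGroup 𝓘(ℝ, E) ∞
  have : ProperSpace E := FiniteDimensional.proper ℝ E
  have : SecondCountableTopology G := ChartedSpace.secondCountable_of_sigmaCompact E G
  have h1 : ∀ S : Set G, μ (δ.dil r '' S) = mulEquivHaarChar (δ.dilEquiv r hr) * μ S := by
    intro S
    have := mulEquivHaarChar_smul_preimage μ (X := δ.dil r '' S) (δ.dilEquiv r hr)
    rw [coe_dilEquiv, preimage_image_eq S (f := δ.dil r) (δ.dilEquiv r hr).injective] at this
    exact this.symm
  refine ⟨mulEquivHaarChar (δ.dilEquiv r hr), h1, fun n => ?_⟩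
  induction n with
  | zero => intro S; simp [δ.dil_one]
  | succ n ih =>
    intro S
    have : δ.dil (r ^ (n + 1)) '' S = δ.dil r '' (δ.dil (r ^ n) '' S) := by
      rw [image_image]
      exact image_congr fun x _ => δ.dil_pow_succ_apply hr n x
    rw [this, h1, ih, pow_succ', mul_assoc]

/-- The set `S` may shrink with `r`, but `C` may not depend on `r`: this uniformity is what the
iteration in `measure_image_dil_le` needs. The constant comes from two chart comparisons and a
factor 2 of slack in the determinant. -/
theorem exists_measure_image_dil_le (δ : DilationFamily E G) (μ : Measure G) [μ.IsHaarMeasure] :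
    ∃ C : ℝ≥0∞, C ≠ ⊤ ∧ ∀ r : ℝ, 0 < r → ∃ S : Set G, μ S ≠ 0 ∧ μ S ≠ ⊤ ∧
      μ (δ.dil r '' S) ≤ C * ENNReal.ofReal (r ^ δ.homogeneousDim) * μ S := by
  borelize E
  have : ProperSpace E := FiniteDimensional.proper ℝ E
  obtain ⟨C, hC, V, hV, hVt, hcomp⟩ := LieGroup.exists_haar_comparable_in_chart (E := E) μ
  set φ := chartAt E (1 : G) with hφ
  set m : Measure E := Measure.hausdorffMeasure (Module.finrank ℝ E) with hm
  have h1 : (1 : G) ∈ φ.source := mem_chart_source E 1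
  have ha : φ 1 ∈ φ.target := φ.map_source h1
  refine ⟨C * 2 * C, ENNReal.mul_ne_top (ENNReal.mul_ne_top hC (by simp)) hC, fun r hr => ?_⟩
  have hf := δ.hasStrictFDerivAt_in_chart hr
  rw [← hφ] at hf
  set f : E → E := fun x => φ (δ.dil r (φ.symm x)) with hfdef
  have hrpos : 0 < r ^ δ.homogeneousDim := Real.rpow_pos_of_pos hr _
  obtain ⟨c, hc, hc0⟩ := ((addHaar_image_le_mul_of_det_lt m
    (NormedSpace.exp (Real.log r • δ.gen)) (m := (2 * r ^ δ.homogeneousDim).toNNReal) (by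
      rw [δ.det_exp_log_smul_gen hr, abs_of_pos hrpos]
      exact (ENNReal.ofReal_lt_ofReal_iff (by positivity)).2 (by linarith))).and
        self_mem_nhdsWithin).exists
  obtain ⟨s, hs, happ⟩ := hf.approximates_deriv_on_nhds (c := c) (Or.inr hc0)
  have hcont : ContinuousAt (fun x => δ.dil r (φ.symm x)) (φ 1) :=
    (δ.continuous_dil hr).continuousAt.comp (φ.symm.continuousAt ha)
  have hval : δ.dil r (φ.symm (φ 1)) = 1 := by rw [φ.left_inv h1, map_one]
  have hpre : (fun x => δ.dil r (φ.symm x)) ⁻¹' (φ.source ∩ φ ⁻¹' V) ∈ 𝓝 (φ 1) := by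
    refine hcont ?_
    simp only [hval]
    exact inter_mem (φ.open_source.mem_nhds h1) (φ.continuousAt h1 hV)
  set T : Set E := interior (s ∩ V ∩ Metric.ball (φ 1) 1 ∩
    (fun x => δ.dil r (φ.symm x)) ⁻¹' (φ.source ∩ φ ⁻¹' V)) with hT
  have hTsub := interior_subset (s := s ∩ V ∩ Metric.ball (φ 1) 1 ∩
    (fun x => δ.dil r (φ.symm x)) ⁻¹' (φ.source ∩ φ ⁻¹' V))
  rw [← hT] at hTsub
  have hTo : IsOpen T := isOpen_interior
  have hTa : φ 1 ∈ T := mem_interior_iff_mem_nhds.2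
    (inter_mem (inter_mem (inter_mem hs hV) (Metric.ball_mem_nhds _ one_pos)) hpre)
  have hTV : T ⊆ V := fun x hx => (hTsub hx).1.1.2
  have hTfin : m T ≠ ⊤ :=
    ((measure_mono fun x hx => (hTsub hx).1.2).trans_lt Metric.isBounded_ball.measure_lt_top).ne
  have hSo : IsOpen (φ.symm '' T) :=
    φ.symm.isOpen_image_of_subset_source hTo (hTV.trans hVt)
  have himg : f '' T = φ '' (δ.dil r '' (φ.symm '' T)) := by
    rw [image_image, image_image]
  have hfo : IsOpen (f '' T) := by
    rw [himg]
    refine φ.isOpen_image_of_subset_source (δ.isOpenMap_dil hr _ hSo) ?_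
    rw [image_image]
    rintro _ ⟨x, hx, rfl⟩
    exact (hTsub hx).2.1
  have hfV : f '' T ⊆ V := by
    rintro _ ⟨x, hx, rfl⟩
    exact (hTsub hx).2.2
  have hback : φ.symm '' (f '' T) = δ.dil r '' (φ.symm '' T) := by
    rw [image_image, image_image]
    exact image_congr fun x hx => φ.left_inv (hTsub hx).2.1
  have hsmall := hc T f (happ.mono_set fun x hx => (hTsub hx).1.1.1)
  refine ⟨φ.symm '' T, (hSo.measure_pos μ ⟨_, mem_image_of_mem _ hTa⟩).ne', ?_, ?_⟩
  · exact ((hcomp T hTV hTo).1.trans_lt (ENNReal.mul_lt_top hC.lt_top hTfin.lt_top)).ne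
  · calc μ (δ.dil r '' (φ.symm '' T)) = μ (φ.symm '' (f '' T)) := by rw [hback]
      _ ≤ C * m (f '' T) := (hcomp _ hfV hfo).1
      _ ≤ C * (ENNReal.ofReal (2 * r ^ δ.homogeneousDim) * (C * μ (φ.symm '' T))) := by
        gcongr
        exact hsmall.trans (mul_le_mul_right (hcomp T hTV hTo).2 _)
      _ = C * 2 * C * ENNReal.ofReal (r ^ δ.homogeneousDim) * μ (φ.symm '' T) := by
        rw [ENNReal.ofReal_mul (by norm_num), ENNReal.ofReal_ofNat]
        ring

/-- The dilation `δ_r` multiplies Haar measure by at most `r ^ ρ`. -/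
theorem measure_image_dil_le (δ : DilationFamily E G) (μ : Measure G) [μ.IsHaarMeasure]
    {r : ℝ} (hr : 0 < r) (S : Set G) :
    μ (δ.dil r '' S) ≤ ENNReal.ofReal (r ^ δ.homogeneousDim) * μ S := by
  obtain ⟨J, hJ, hJn⟩ := δ.exists_measure_image_dil_eq μ hr
  obtain ⟨C, hC, hle⟩ := δ.exists_measure_image_dil_le μ
  lift C to NNReal using hC
  have hrpos : 0 < r ^ δ.homogeneousDim := Real.rpow_pos_of_pos hr _
  -- The bound is applied to `δ_{r^n}`, whose modulus is `J ^ n`. If `J > r^ρ`, then `(J / r^ρ) ^ n`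
  -- would outgrow the fixed `C`.
  have key : ∀ n : ℕ, (J : ℝ) ^ n ≤ C * (r ^ δ.homogeneousDim) ^ n := by
    intro n
    obtain ⟨S, h0, hfin, h⟩ := hle (r ^ n) (pow_pos hr n)
    rw [hJn, ENNReal.mul_le_mul_iff_left h0 hfin, ← Real.rpow_pow_comm hr.le] at h
    have h' := ENNReal.toReal_mono (by finiteness) h
    rwa [ENNReal.toReal_pow, ENNReal.coe_toReal, ENNReal.toReal_mul, ENNReal.coe_toReal,
      ENNReal.toReal_ofReal (by positivity)] at h'
  have hJle : (J : ℝ) ≤ r ^ δ.homogeneousDim := by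
    by_contra! hlt
    obtain ⟨n, hn⟩ := pow_unbounded_of_one_lt (C : ℝ) ((one_lt_div hrpos).2 hlt)
    rw [div_pow, lt_div_iff₀ (by positivity)] at hn
    exact absurd (key n) (not_le.2 hn)
  rw [hJ]
  gcongr
  rw [← ENNReal.ofReal_coe_nnreal]
  exact ENNReal.ofReal_le_ofReal hJle

end Measure

end DilationFamily

/-! ### Contraction by dilations, compactness of balls, the constant `γ`. -/

theorem IsPreconnected.inter_frontier_nonempty {X : Type*} [TopologicalSpace X] {s u : Set X}
    (hs : IsPreconnected s) (h₁ : (s ∩ u).Nonempty) (h₂ : (s \ u).Nonempty) :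
    (s ∩ frontier u).Nonempty := by
  by_contra h
  have hd : ∀ x ∈ s, x ∈ closure u → x ∈ interior u := fun x hx hc => by
    by_contra hi
    exact h ⟨x, hx, hc, hi⟩
  obtain ⟨x, hx, hxu⟩ := h₁
  obtain ⟨y, hy, hyu⟩ := h₂
  obtain ⟨z, -, hz, hz'⟩ := hs (interior u) (closure u)ᶜ isOpen_interior isClosed_closure.isOpen_compl
    (fun z hz => (em (z ∈ closure u)).imp (hd z hz) id)
    ⟨x, hx, hd x hx (subset_closure hxu)⟩
    ⟨y, hy, fun hc => hyu (interior_subset (hd y hy hc))⟩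
  exact hz' (subset_closure (interior_subset hz))

namespace DilationFamily

variable {E G : Type*} [NormedAddCommGroup E] [NormedSpace ℝ E] [FiniteDimensional ℝ E]
  [TopologicalSpace G] [ChartedSpace E G] [Group G] [LieGroup 𝓘(ℝ, E) ∞ G]

/-- Some dilation contracts a neighbourhood of the identity to the identity. -/
theorem exists_eventually_tendsto_dil_pow (δ : DilationFamily E G) :
    ∃ r : ℝ, 0 < r ∧ r < 1 ∧
      ∀ᶠ x in 𝓝 (1 : G), Tendsto (fun n : ℕ => δ.dil (r ^ n) x) atTop (𝓝 1) := by
  obtain ⟨r, hr, hr1, hnorm⟩ := δ.exists_norm_exp_log_smul_gen_lt (ε := 1 / 2) (by norm_num)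
  refine ⟨r, hr, hr1, ?_⟩
  have hf := δ.hasStrictFDerivAt_in_chart hr
  set φ := chartAt E (1 : G) with hφ
  have h1 : (1 : G) ∈ φ.source := mem_chart_source E 1
  have ha : φ 1 ∈ φ.target := φ.map_source h1
  -- The derivative has norm below `1/2`, so by strict differentiability the dilation is a
  -- `1/2`-contraction near its fixed point.
  obtain ⟨s, hs, hlip⟩ := hf.exists_lipschitzOnWith_of_nnnorm_lt (1 / 2 : NNReal) (by
    rw [← NNReal.coe_lt_coe]; simpa using hnorm)
  have hcont : ContinuousAt (fun x => δ.dil r (φ.symm x)) (φ 1) :=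
    (δ.continuous_dil hr).continuousAt.comp (φ.symm.continuousAt ha)
  have hval : δ.dil r (φ.symm (φ 1)) = 1 := by rw [φ.left_inv h1, map_one]
  have hpre : (fun x => δ.dil r (φ.symm x)) ⁻¹' φ.source ∈ 𝓝 (φ 1) := by
    refine hcont ?_
    simp only [hval]
    exact φ.open_source.mem_nhds h1
  obtain ⟨ε, hε, hball⟩ := Metric.mem_nhds_iff.1 (inter_mem hs hpre)
  have hmem : φ.source ∩ φ ⁻¹' Metric.ball (φ 1) ε ∈ 𝓝 (1 : G) :=
    inter_mem (φ.open_source.mem_nhds h1) (φ.continuousAt h1 (Metric.ball_mem_nhds _ hε))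
  filter_upwards [hmem] with x hx
  have hind : ∀ n : ℕ, δ.dil (r ^ n) x ∈ φ.source ∧
      dist (φ (δ.dil (r ^ n) x)) (φ 1) ≤ (1 / 2) ^ n * dist (φ x) (φ 1) := by
    intro n
    induction n with
    | zero => simpa [δ.dil_one] using hx.1
    | succ n ih =>
      have hb : φ (δ.dil (r ^ n) x) ∈ Metric.ball (φ 1) ε := by
        refine (ih.2.trans ?_).trans_lt hx.2
        exact mul_le_of_le_one_left dist_nonneg (pow_le_one₀ (by norm_num) (by norm_num))
      have hb' := hball hb
      have h2 : δ.dil (r ^ (n + 1)) x = δ.dil r (φ.symm (φ (δ.dil (r ^ n) x))) := by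
        rw [φ.left_inv ih.1, δ.dil_pow_succ_apply hr]
      refine ⟨h2 ▸ hb'.2, ?_⟩
      have h3 := hlip.dist_le_mul _ hb'.1 _ (mem_of_mem_nhds hs)
      simp only [hval] at h3
      rw [h2, pow_succ', mul_assoc]
      refine h3.trans ?_
      simpa using ih.2
  have hlim : Tendsto (fun n : ℕ => φ (δ.dil (r ^ n) x)) atTop (𝓝 (φ 1)) := by
    rw [tendsto_iff_dist_tendsto_zero]
    refine squeeze_zero (fun _ => dist_nonneg) (fun n => (hind n).2) ?_
    simpa using (tendsto_pow_atTop_nhds_zero_of_lt_one (r := (1 / 2 : ℝ))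
      (by norm_num) (by norm_num)).mul_const (dist (φ x) (φ 1))
  have h4 := (φ.symm.continuousAt ha).tendsto.comp hlim
  rw [φ.left_inv h1] at h4
  exact h4.congr fun n => φ.left_inv (hind n).1

/-- The points contracted to the identity form a subgroup that is open, hence also closed, hence all
of the connected group. -/
theorem exists_tendsto_dil_pow [PreconnectedSpace G] (δ : DilationFamily E G) :
    ∃ r : ℝ, 0 < r ∧ r < 1 ∧
      ∀ x : G, Tendsto (fun n : ℕ => δ.dil (r ^ n) x) atTop (𝓝 1) := by
  have : IsTopologicalGroup G := topologicalGroup_of_lieGroup 𝓘(ℝ, E) ∞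
  obtain ⟨r, hr, hr1, hev⟩ := δ.exists_eventually_tendsto_dil_pow
  let H : Subgroup G :=
    { carrier := {x | Tendsto (fun n : ℕ => δ.dil (r ^ n) x) atTop (𝓝 1)}
      mul_mem' := fun {x y} hx hy => by simpa using Tendsto.mul hx hy
      one_mem' := by simp [tendsto_const_nhds]
      inv_mem' := fun {x} hx => by simpa using Tendsto.inv hx }
  have ho : IsOpen (H : Set G) := H.isOpen_of_mem_nhds hev
  have hu : (H : Set G) = univ :=
    IsClopen.eq_univ ⟨H.isClosed_of_isOpen ho, ho⟩ ⟨1, H.one_mem⟩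
  exact ⟨r, hr, hr1, fun x => (hu ▸ mem_univ x : x ∈ (H : Set G))⟩

end DilationFamily

namespace HomogeneousNorm

theorem toFun_one {E G : Type*} [NormedAddCommGroup E] [NormedSpace ℝ E]
    [TopologicalSpace G] [ChartedSpace E G] [Group G] {δ : DilationFamily E G}
    (N : HomogeneousNorm δ) : N.toFun 1 = 0 :=
  (N.eq_zero_iff 1).2 rfl

section Compact

variable {E G : Type*} [NormedAddCommGroup E] [NormedSpace ℝ E] [FiniteDimensional ℝ E]
  [TopologicalSpace G] [T2Space G] [ChartedSpace E G] [Group G] [LieGroup 𝓘(ℝ, E) ∞ G]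
  [PreconnectedSpace G] {δ : DilationFamily E G}

/-- The norm has a positive lower bound `m` on the frontier of a compact neighbourhood `K`. If `x ∉
K`, the curve `s ↦ δ_s x`, `s ≤ 1`, enters `K` and crosses the frontier, so `|x| ≥ s|x| ≥ m`. Thus
`{|x| < m} ⊆ K`, and dilating reaches every radius. -/
theorem isCompact_setOf_le (N : HomogeneousNorm δ) (R : ℝ) :
    IsCompact {x : G | N.toFun x ≤ R} := by
  have : LocallyCompactSpace G := Manifold.locallyCompact_of_finiteDimensional (M := G) 𝓘(ℝ, E)
  obtain ⟨r, hr, hr1, hlim⟩ := δ.exists_tendsto_dil_pow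
  obtain ⟨K, hK, hK1⟩ := exists_compact_mem_nhds (1 : G)
  have hfr : IsCompact (frontier K) :=
    hK.of_isClosed_subset isClosed_frontier hK.isClosed.frontier_subset
  obtain ⟨m, hm, hmin⟩ : ∃ m : ℝ, 0 < m ∧ ∀ x ∈ frontier K, m ≤ N.toFun x := by
    rcases (frontier K).eq_empty_or_nonempty with h | h
    · exact ⟨1, one_pos, by simp [h]⟩
    · obtain ⟨x, hx, hle⟩ := hfr.exists_isMinOn h N.continuous.continuousOn
      refine ⟨N.toFun x, (N.nonneg x).lt_of_ne' fun h0 => ?_, fun y hy => hle hy⟩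
      rw [N.eq_zero_iff] at h0
      subst h0
      exact hx.2 (mem_interior_iff_mem_nhds.2 hK1)
  have hsub : ∀ x, N.toFun x < m → x ∈ K := by
    intro x hx
    by_contra hxK
    obtain ⟨n, hn⟩ := ((hlim x).eventually hK1).exists
    have hle : r ^ n ≤ 1 := pow_le_one₀ hr.le hr1.le
    have hpre : IsPreconnected ((fun s : ℝ => δ.dil s x) '' Icc (r ^ n) 1) := by
      refine isPreconnected_Icc.image _ ?_
      refine δ.dil_continuous.comp (f := fun s : ℝ => (s, x)) (by fun_prop) ?_
      exact fun s hs => ⟨(pow_pos hr n).trans_le hs.1, mem_univ _⟩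
    obtain ⟨_, ⟨s, hs, rfl⟩, hsfr⟩ := hpre.inter_frontier_nonempty (u := K)
      ⟨δ.dil (r ^ n) x, mem_image_of_mem _ (left_mem_Icc.2 hle), hn⟩
      ⟨δ.dil 1 x, mem_image_of_mem _ (right_mem_Icc.2 hle), by simpa [δ.dil_one] using hxK⟩
    have h1 := hmin _ hsfr
    have hs0 : 0 < s := (pow_pos hr n).trans_le hs.1
    rw [N.homogeneous s hs0] at h1
    exact absurd (h1.trans (mul_le_of_le_one_left (N.nonneg x) hs.2)) (not_le.2 hx)
  have hcl : IsClosed {x : G | N.toFun x ≤ R} := isClosed_le N.continuous continuous_const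
  -- The maximum keeps the dilation factor positive when `R ≤ 0`; after dilation by its inverse the
  -- norm is at most `m / 2`.
  set R' := max R 1 with hR'
  have hR : 0 < R' := lt_max_of_lt_right one_pos
  have ht : 0 < 2 * R' / m := by positivity
  refine (hK.image (δ.continuous_dil ht)).of_isClosed_subset hcl fun x hx => ?_
  refine ⟨δ.dil (2 * R' / m)⁻¹ x, hsub _ ?_, δ.dil_dil_inv ht x⟩
  rw [N.homogeneous _ (inv_pos.2 ht), inv_div, div_mul_eq_mul_div, div_lt_iff₀ (by positivity)]
  have hx' : N.toFun x ≤ R' := le_trans hx (le_max_left _ _)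
  nlinarith

/-- By homogeneity one may scale to `|x| + |y| = 1`, where `|xy|` is bounded by compactness. -/
theorem exists_quasi_triangle (N : HomogeneousNorm δ) :
    ∃ c : ℝ, 0 < c ∧ ∀ x y : G, N.toFun (x * y) ≤ c * (N.toFun x + N.toFun y) := by
  have : IsTopologicalGroup G := topologicalGroup_of_lieGroup 𝓘(ℝ, E) ∞
  have hB := N.isCompact_setOf_le 1
  obtain ⟨C, hC⟩ := (hB.prod hB).exists_bound_of_continuousOn (f := fun z => N.toFun (z.1 * z.2))
    (N.continuous.comp continuous_mul).continuousOn
  refine ⟨max C 1, lt_max_of_lt_right one_pos, fun x y => ?_⟩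
  rcases (add_nonneg (N.nonneg x) (N.nonneg y)).eq_or_lt with h | h
  · have hx : x = 1 := (N.eq_zero_iff x).1 (by linarith [N.nonneg x, N.nonneg y])
    have hy : y = 1 := (N.eq_zero_iff y).1 (by linarith [N.nonneg x, N.nonneg y])
    simp [hx, hy, N.toFun_one]
  · set t := N.toFun x + N.toFun y with ht
    have h1 : ∀ z, N.toFun z ≤ t → N.toFun (δ.dil t⁻¹ z) ≤ 1 := by
      intro z hz
      rw [N.homogeneous _ (inv_pos.2 h), inv_mul_le_iff₀ h, mul_one]
      exact hz
    have h2 := hC (δ.dil t⁻¹ x, δ.dil t⁻¹ y)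
      ⟨h1 x (by linarith [N.nonneg y]), h1 y (by linarith [N.nonneg x])⟩
    simp only at h2
    rw [← map_mul, N.homogeneous _ (inv_pos.2 h)] at h2
    have h3 := ((le_abs_self _).trans h2).trans (le_max_left C 1)
    rwa [inv_mul_le_iff₀ h, mul_comm] at h3

/-- The set defining `γ` is nonempty, so its `sInf` is not a default value; the inequality passes to
the infimum. -/
theorem toFun_mul_le (N : HomogeneousNorm δ) (x y : G) :
    N.toFun (x * y) ≤ N.quasiConst * (N.toFun x + N.toFun y) := by
  rcases (add_nonneg (N.nonneg x) (N.nonneg y)).eq_or_lt with h | h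
  · obtain ⟨c, -, hc⟩ := N.exists_quasi_triangle
    simpa [← h] using hc x y
  · rw [← div_le_iff₀ h]
    refine le_csInf N.exists_quasi_triangle fun c hc => ?_
    rw [div_le_iff₀ h]
    exact hc.2 x y

theorem one_le_quasiConst [Nontrivial G] (N : HomogeneousNorm δ) : 1 ≤ N.quasiConst := by
  obtain ⟨x, hx⟩ := exists_ne (1 : G)
  have h := N.toFun_mul_le x 1
  have hpos : 0 < N.toFun x := (N.nonneg x).lt_of_ne' fun h0 => hx ((N.eq_zero_iff x).1 h0)
  rw [mul_one, N.toFun_one, add_zero] at h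
  exact (le_mul_iff_one_le_left hpos).1 h

end Compact

end HomogeneousNorm

/-! ### Counting the members of a partition that meet a ball. -/

namespace HomogeneousNorm

section Ball

variable {E G : Type*} [NormedAddCommGroup E] [NormedSpace ℝ E]
  [TopologicalSpace G] [ChartedSpace E G] [Group G] {δ : DilationFamily E G}

theorem mem_ball_one (N : HomogeneousNorm δ) {r : ℝ} {x : G} :
    x ∈ N.ball 1 r ↔ N.toFun x < r := by
  simp [ball]

theorem isOpen_ball_one (N : HomogeneousNorm δ) (r : ℝ) : IsOpen (N.ball 1 r) := by
  simpa [ball] using isOpen_lt N.continuous continuous_const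

theorem one_mem_ball_one (N : HomogeneousNorm δ) {r : ℝ} (hr : 0 < r) : (1 : G) ∈ N.ball 1 r := by
  rwa [mem_ball_one, toFun_one]

theorem ball_one_subset_image_dil (N : HomogeneousNorm δ) {k : ℝ} (hk : 0 < k) (s : ℝ) :
    N.ball 1 (k * s) ⊆ δ.dil k '' N.ball 1 s := by
  intro x hx
  refine ⟨δ.dil k⁻¹ x, ?_, δ.dil_dil_inv hk x⟩
  rw [mem_ball_one] at hx ⊢
  rwa [N.homogeneous _ (inv_pos.2 hk), inv_mul_lt_iff₀ hk]

end Ball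

section Count

variable {E G : Type*} [NormedAddCommGroup E] [NormedSpace ℝ E] [FiniteDimensional ℝ E]
  [TopologicalSpace G] [T2Space G] [ChartedSpace E G] [Group G]
  [LieGroup 𝓘(ℝ, E) ∞ G] [PreconnectedSpace G] [Nontrivial G] {δ : DilationFamily E G}

/-- Writing `y = xuv`, three uses of the quasi-triangle inequality bound `|xw|` by `(2γ³ + γ² +
γ)R`; since `γ ≥ 1` the stated constant dominates. -/
theorem smul_ball_one_subset (N : HomogeneousNorm δ) {R : ℝ} {x y : G}
    (hy : y ∈ N.ball 1 R) (hyx : y ∈ x • (N.ball 1 R * N.ball 1 R)) :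
    x • N.ball 1 R ⊆ N.ball 1 ((4 * N.quasiConst ^ 4 + 3 * N.quasiConst ^ 2) * R) := by
  set γ := N.quasiConst with hγ
  have hγ1 : 1 ≤ γ := N.one_le_quasiConst
  obtain ⟨_, ⟨u, hu, v, hv, rfl⟩, huv⟩ := hyx
  simp only [smul_eq_mul] at huv
  rintro _ ⟨w, hw, rfl⟩
  rw [mem_ball_one] at hu hv hw hy ⊢
  have hR : 0 < R := (N.nonneg y).trans_lt hy
  have h1 : N.toFun (u * v) ≤ γ * (R + R) :=
    (N.toFun_mul_le u v).trans (by gcongr)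
  have h2 : N.toFun x ≤ γ * (R + γ * (R + R)) := by
    have : x = y * (u * v)⁻¹ := eq_mul_inv_of_mul_eq huv
    rw [this]
    refine (N.toFun_mul_le _ _).trans ?_
    rw [N.inv]
    gcongr
  have h3 : N.toFun (x * w) < γ * (γ * (R + γ * (R + R)) + R) := by
    refine (N.toFun_mul_le x w).trans_lt ?_
    have : 0 < γ := by linarith
    exact mul_lt_mul_of_pos_left (add_lt_add_of_le_of_lt h2 hw) this
  refine h3.trans_le ?_
  have h4 : γ ≤ γ ^ 2 := le_self_pow₀ hγ1 (by norm_num)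
  have h5 : γ ^ 3 ≤ γ ^ 4 := pow_le_pow_right₀ hγ1 (by norm_num)
  have h6 : 0 ≤ γ ^ 4 := by positivity
  have h7 : γ ^ 2 + 2 * γ ^ 3 + γ ≤ 4 * γ ^ 4 + 3 * γ ^ 2 := by nlinarith
  calc γ * (γ * (R + γ * (R + R)) + R) = (γ ^ 2 + 2 * γ ^ 3 + γ) * R := by ring
    _ ≤ (4 * γ ^ 4 + 3 * γ ^ 2) * R := mul_le_mul_of_nonneg_right h7 hR.le

variable [SigmaCompactSpace G] [MeasurableSpace G] [BorelSpace G]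

/-- At most `(4γ⁴ + 3γ²) ^ ρ` members of a `B(e, R)`-`B(e, R)²` uniform partition meet
`B(e, R)`. -/
theorem card_le_of_inter_ball_nonempty (N : HomogeneousNorm δ) (μ : Measure G) [μ.IsHaarMeasure]
    {R : ℝ} (hR : 0 < R) {π : Set (Set G)}
    (hπ : IsUniformPartition (N.ball 1 R) (N.ball 1 R * N.ball 1 R) π) (T : Finset (Set G))
    (hT : ∀ F ∈ T, F ∈ π ∧ (F ∩ N.ball 1 R).Nonempty) :
    (T.card : ℝ≥0∞) ≤
      ENNReal.ofReal ((4 * N.quasiConst ^ 4 + 3 * N.quasiConst ^ 2) ^ δ.homogeneousDim) := by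
  have : IsTopologicalGroup G := topologicalGroup_of_lieGroup 𝓘(ℝ, E) ∞
  set U := N.ball 1 R with hU
  set k := 4 * N.quasiConst ^ 4 + 3 * N.quasiConst ^ 2 with hk
  have hk0 : 0 < k := by
    have := N.one_le_quasiConst
    positivity
  have hUpos : μ U ≠ 0 := ((N.isOpen_ball_one R).measure_pos μ ⟨1, N.one_mem_ball_one hR⟩).ne'
  have hUfin : μ U ≠ ⊤ := by
    refine ((measure_mono fun x hx => ?_).trans_lt (N.isCompact_setOf_le R).measure_lt_top).ne
    exact (N.mem_ball_one.1 hx).le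
  have hc : ∀ F : Set G, ∃ x : G, F ∈ π → x • U ⊆ F ∧ F ⊆ x • (U * U) := by
    intro F
    by_cases hF : F ∈ π
    · obtain ⟨x, -, h⟩ := hπ.exists_center F hF
      exact ⟨x, fun _ => h⟩
    · exact ⟨1, fun h => absurd h hF⟩
  choose x hx using hc
  have hdisj : (T : Set (Set G)).PairwiseDisjoint fun F => x F • U := by
    intro F hF F' hF' hne
    exact (hπ.isPartition.pairwiseDisjoint (hT F hF).1 (hT F' hF').1 hne).mono
      (hx F (hT F hF).1).1 (hx F' (hT F' hF').1).1
  have hsum : μ (⋃ F ∈ T, x F • U) = T.card * μ U := by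
    rw [measure_biUnion_finset hdisj fun F _ => ((N.isOpen_ball_one R).smul (x F)).measurableSet]
    simp [measure_smul]
  have hsub : (⋃ F ∈ T, x F • U) ⊆ N.ball 1 (k * R) := by
    refine iUnion₂_subset fun F hF => ?_
    obtain ⟨y, hyF, hyU⟩ := (hT F hF).2
    exact N.smul_ball_one_subset hyU ((hx F (hT F hF).1).2 hyF)
  -- Volume comparison: `T.card` disjoint translates of `U` fit into a dilate of `U` by `k`.
  have hle : T.card * μ U ≤ ENNReal.ofReal (k ^ δ.homogeneousDim) * μ U := by
    rw [← hsum]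
    exact (measure_mono (hsub.trans (N.ball_one_subset_image_dil hk0 R))).trans
      (δ.measure_image_dil_le μ hk0 _)
  exact (ENNReal.mul_le_mul_iff_left hUpos hUfin).1 hle

theorem finite_inter_ball_nonempty (N : HomogeneousNorm δ) {R : ℝ} (hR : 0 < R)
    {π : Set (Set G)} (hπ : IsUniformPartition (N.ball 1 R) (N.ball 1 R * N.ball 1 R) π) :
    {F | F ∈ π ∧ (F ∩ N.ball 1 R).Nonempty}.Finite := by
  have : LocallyCompactSpace G := Manifold.locallyCompact_of_finiteDimensional (M := G) 𝓘(ℝ, E)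
  have : IsTopologicalGroup G := topologicalGroup_of_lieGroup 𝓘(ℝ, E) ∞
  by_contra hinf
  obtain ⟨n, hn⟩ := ENNReal.exists_nat_gt (ENNReal.ofReal_ne_top
    (r := (4 * N.quasiConst ^ 4 + 3 * N.quasiConst ^ 2) ^ δ.homogeneousDim))
  obtain ⟨T, hT, rfl⟩ := Set.Infinite.exists_subset_card_eq hinf n
  exact absurd (N.card_le_of_inter_ball_nonempty Measure.haar hR hπ T fun F hF => hT hF)
    (not_le.2 hn)

end Count

end HomogeneousNorm

/-! ### Countability of partitions and comparison of `ℓ^q` with `ℓ^p`. -/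

theorem IsUniformPartition.countable {G : Type*} [Group G] [MeasurableSpace G]
    [TopologicalSpace G] [ContinuousMul G] [TopologicalSpace.SeparableSpace G] {U V : Set G}
    {π : Set (Set G)} (hπ : IsUniformPartition U V π) (hU : IsOpen U) (hU' : U.Nonempty) :
    π.Countable := by
  refine hπ.isPartition.pairwiseDisjoint.countable_of_nonempty_interior fun F hF => ?_
  obtain ⟨x, -, hx, -⟩ := hπ.exists_center F hF
  exact (hU'.smul_set (a := x)).mono (interior_maximal hx (hU.smul x))

/-- Each `a i` is at most the `ℓ^q` norm `S`, so `a i ^ p ≤ a i ^ q * S ^ (p - q)`; sum over `i`. -/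
theorem ENNReal.tsum_rpow_rpow_inv_le_of_le {ι : Type*} (a : ι → ℝ≥0∞) {q p : ℝ} (hq : 0 < q)
    (hqp : q ≤ p) : (∑' i, a i ^ p) ^ (1 / p) ≤ (∑' i, a i ^ q) ^ (1 / q) := by
  have hp : 0 < p := hq.trans_le hqp
  set S := (∑' i, a i ^ q) ^ (1 / q) with hS
  have hSq : S ^ q = ∑' i, a i ^ q := by
    rw [hS, ← ENNReal.rpow_mul, one_div_mul_cancel hq.ne', ENNReal.rpow_one]
  have hle : ∀ i, a i ≤ S := by
    intro i
    rw [hS, one_div, ENNReal.le_rpow_inv_iff hq]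
    exact ENNReal.le_tsum i
  rw [one_div, ENNReal.rpow_inv_le_iff hp]
  calc ∑' i, a i ^ p ≤ ∑' i, a i ^ q * S ^ (p - q) := by
        refine ENNReal.tsum_le_tsum fun i => ?_
        calc a i ^ p = a i ^ q * a i ^ (p - q) := by
              rw [← ENNReal.rpow_add_of_nonneg _ _ hq.le (sub_nonneg.2 hqp)]
              congr 1; ring
          _ ≤ a i ^ q * S ^ (p - q) := by
              gcongr
              exact hle i
    _ = S ^ p := by
        rw [ENNReal.tsum_mul_right, ← hSq,
          ← ENNReal.rpow_add_of_nonneg _ _ hq.le (sub_nonneg.2 hqp)]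
        congr 1; ring

theorem ENNReal.sum_rpow_rpow_inv_le_card_mul {ι : Type*} (s : Finset ι) (a : ι → ℝ≥0∞) {q p : ℝ}
    (hq : 0 < q) (hqp : q ≤ p) :
    (∑ i ∈ s, a i ^ q) ^ (1 / q) ≤
      (s.card : ℝ≥0∞) ^ (q⁻¹ - p⁻¹) * (∑ i ∈ s, a i ^ p) ^ (1 / p) := by
  have hp : 0 < p := hq.trans_le hqp
  have h := ENNReal.rpow_sum_le_const_mul_sum_rpow s (fun i => a i ^ q) ((one_le_div hq).2 hqp)
  have h' := ENNReal.rpow_le_rpow h (z := 1 / p) (by positivity)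
  rw [ENNReal.mul_rpow_of_nonneg _ _ (by positivity), ← ENNReal.rpow_mul, ← ENNReal.rpow_mul] at h'
  have e1 : p / q * (1 / p) = 1 / q := by field_simp
  have e2 : (p / q - 1) * (1 / p) = q⁻¹ - p⁻¹ := by field_simp
  have e3 : ∀ i, (a i ^ q) ^ (p / q) = a i ^ p := fun i => by
    rw [← ENNReal.rpow_mul]; congr 1; field_simp
  simp_rw [e3] at h'
  rwa [e1, e2] at h'

/-! ### Amalgam norms against the `L^q` norm. -/

section Amalgam

variable {G : Type*} [MeasurableSpace G] {μ : Measure G} {π : Set (Set G)} {q p : ℝ≥0∞}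

theorem eLpNorm_indicator_rpow_toReal (hq0 : q ≠ 0) (hq : q ≠ ⊤) {s : Set G}
    (hs : MeasurableSet s) (f : G → ℂ) :
    eLpNorm (s.indicator f) q μ ^ q.toReal = ∫⁻ x in s, ‖f x‖ₑ ^ q.toReal ∂μ := by
  rw [eLpNorm_indicator_eq_eLpNorm_restrict hs, eLpNorm_eq_lintegral_rpow_enorm_toReal hq0 hq,
    ← ENNReal.rpow_mul, one_div_mul_cancel (ENNReal.toReal_pos hq0 hq).ne', ENNReal.rpow_one]

theorem amalgamNorm_le_eLpNorm (hπ : Setoid.IsPartition π) (hπc : π.Countable)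
    (hπm : ∀ F ∈ π, MeasurableSet F) (hq : 1 ≤ q) (hqp : q ≤ p) (f : G → ℂ) :
    amalgamNorm μ q p π f ≤ eLpNorm f q μ := by
  unfold amalgamNorm
  split_ifs with hp
  · exact iSup₂_le fun F _ => eLpNorm_indicator_le f
  · have hqt : q ≠ ⊤ := ne_top_of_le_ne_top hp hqp
    have hq0 : q ≠ 0 := (zero_lt_one.trans_le hq).ne'
    refine (ENNReal.tsum_rpow_rpow_inv_le_of_le _ (ENNReal.toReal_pos hq0 hqt)
      (ENNReal.toReal_mono hp hqp)).trans_eq ?_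
    rw [eLpNorm_eq_lintegral_rpow_enorm_toReal hq0 hqt]
    congr 1
    rw [tsum_congr fun F : π => eLpNorm_indicator_rpow_toReal hq0 hqt (hπm F F.2) f,
      ← lintegral_biUnion hπc hπm hπ.pairwiseDisjoint, ← sUnion_eq_biUnion,
      hπ.sUnion_eq_univ, Measure.restrict_univ]

/-- Only the members in `T` contribute on `B`, so Hölder on a finite sum turns `ℓ^q` into `ℓ^p` at
the cost of a power of `T.card`. -/
theorem eLpNorm_indicator_le_card_mul_amalgamNorm (hπ : Setoid.IsPartition π)
    (hπm : ∀ F ∈ π, MeasurableSet F) (hq : 1 ≤ q) (hqt : q ≠ ⊤) (hqp : q ≤ p) (f : G → ℂ)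
    {B : Set G} (hB : MeasurableSet B) (T : Finset (Set G)) (hTπ : ∀ F ∈ T, F ∈ π)
    (hT : ∀ F ∈ π, (F ∩ B).Nonempty → F ∈ T) :
    eLpNorm (B.indicator f) q μ ≤
      (T.card : ℝ≥0∞) ^ ((q⁻¹).toReal - (p⁻¹).toReal) * amalgamNorm μ q p π f := by
  have hq0 : q ≠ 0 := (zero_lt_one.trans_le hq).ne'
  have hqpos : 0 < q.toReal := ENNReal.toReal_pos hq0 hqt
  have hcover : B ⊆ ⋃ F ∈ T, F := by
    intro x hx
    obtain ⟨F, hF, hxF⟩ : x ∈ ⋃₀ π := hπ.sUnion_eq_univ ▸ mem_univ x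
    exact mem_biUnion (hT F hF ⟨x, hxF, hx⟩) hxF
  have hsum : eLpNorm (B.indicator f) q μ ≤
      (∑ F ∈ T, eLpNorm (F.indicator f) q μ ^ q.toReal) ^ (1 / q.toReal) := by
    rw [one_div, ENNReal.le_rpow_inv_iff hqpos, eLpNorm_indicator_rpow_toReal hq0 hqt hB,
      Finset.sum_congr rfl fun F hF =>
        eLpNorm_indicator_rpow_toReal hq0 hqt (hπm F (hTπ F hF)) f]
    exact (lintegral_mono_set hcover).trans_eq (lintegral_biUnion_finset (t := id)
      (hπ.pairwiseDisjoint.subset hTπ) (fun F hF => hπm F (hTπ F hF)) _)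
  refine hsum.trans ?_
  unfold amalgamNorm
  split_ifs with hp
  · set M := ⨆ F ∈ π, eLpNorm (F.indicator f) q μ with hM
    have hFM : ∀ F ∈ T, eLpNorm (F.indicator f) q μ ^ q.toReal ≤ M ^ q.toReal := by
      intro F hF
      refine ENNReal.rpow_le_rpow ?_ hqpos.le
      exact le_iSup₂ (f := fun (F : Set G) (_ : F ∈ π) => eLpNorm (F.indicator f) q μ) F (hTπ F hF)
    have hle : ∑ F ∈ T, eLpNorm (F.indicator f) q μ ^ q.toReal ≤ T.card * M ^ q.toReal := by
      rw [← nsmul_eq_mul]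
      exact Finset.sum_le_card_nsmul _ _ _ hFM
    refine (ENNReal.rpow_le_rpow hle (by positivity)).trans_eq ?_
    rw [ENNReal.mul_rpow_of_nonneg _ _ (by positivity), ← ENNReal.rpow_mul,
      mul_one_div_cancel hqpos.ne', ENNReal.rpow_one, hp]
    simp
  · refine (ENNReal.sum_rpow_rpow_inv_le_card_mul T _ hqpos (ENNReal.toReal_mono hp hqp)).trans ?_
    rw [ENNReal.toReal_inv, ENNReal.toReal_inv]
    gcongr
    classical
    have := ENNReal.sum_le_tsum (T.subtype (· ∈ π))
      (f := fun F : π => eLpNorm ((F : Set G).indicator f) q μ ^ p.toReal)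
    rwa [Finset.sum_subtype_of_mem (fun F => eLpNorm (F.indicator f) q μ ^ p.toReal) hTπ] at this

/-- Countability lets the exceptional null sets of all members be discarded together. -/
theorem eLpNorm_top_le_amalgamNorm (hπ : Setoid.IsPartition π) (hπc : π.Countable) (f : G → ℂ) :
    eLpNorm f ⊤ μ ≤ amalgamNorm μ ⊤ ⊤ π f := by
  rw [amalgamNorm, if_pos rfl, eLpNorm_exponent_top]
  refine eLpNormEssSup_le_of_ae_enorm_bound ?_
  have h := (ae_ball_iff (μ := μ) hπc (p := fun (x : G) (F : Set G) (_ : F ∈ π) => ‖F.indicator f x‖ₑ ≤ eLpNorm (F.indicator f) ⊤ μ)).2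
    fun F _ => enorm_ae_le_eLpNormEssSup (F.indicator f) μ
  filter_upwards [h] with x hx
  obtain ⟨F, hF, hxF⟩ : x ∈ ⋃₀ π := hπ.sUnion_eq_univ ▸ mem_univ x
  have h1 := hx F hF
  rw [indicator_of_mem hxF] at h1
  exact h1.trans (le_iSup₂ (f := fun (F : Set G) (_ : F ∈ π) => eLpNorm (F.indicator f) ⊤ μ) F hF)

theorem eLpNorm_le_of_forall_indicator_le (hq : 1 ≤ q) (hqt : q ≠ ⊤) (f : G → ℂ)
    {B : ℕ → Set G} (hB : ∀ n, MeasurableSet (B n)) (hmono : Monotone B) (hU : ⋃ n, B n = univ)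
    {C : ℝ≥0∞} (hC : ∀ n, eLpNorm ((B n).indicator f) q μ ≤ C) : eLpNorm f q μ ≤ C := by
  have hq0 : q ≠ 0 := (zero_lt_one.trans_le hq).ne'
  have hqpos : 0 < q.toReal := ENNReal.toReal_pos hq0 hqt
  rw [eLpNorm_eq_lintegral_rpow_enorm_toReal hq0 hqt, one_div, ENNReal.rpow_inv_le_iff hqpos,
    ← setLIntegral_univ, ← hU, setLIntegral_iUnion_of_directed _ hmono.directed_le]
  refine iSup_le fun n => ?_
  rw [← eLpNorm_indicator_rpow_toReal hq0 hqt (hB n)]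
  exact ENNReal.rpow_le_rpow (hC n) hqpos.le

end Amalgam

/-! ### The two inequalities and the proposition. -/

theorem fracAmalgamNorm_self {E G : Type*} [NormedAddCommGroup E] [NormedSpace ℝ E]
    [TopologicalSpace G] [ChartedSpace E G] [Group G] [MeasurableSpace G]
    {δ : DilationFamily E G} {N : HomogeneousNorm δ} (μ : Measure G) (π : ℝ → Set (Set G))
    (q p : ℝ≥0∞) (f : G → ℂ) :
    fracAmalgamNorm N μ π q p q f = ⨆ (r : ℝ) (_ : 0 < r), amalgamNorm μ q p (π r) f := by
  simp [fracAmalgamNorm]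

section Main

variable {E G : Type*} [NormedAddCommGroup E] [NormedSpace ℝ E] [FiniteDimensional ℝ E]
  [TopologicalSpace G] [T2Space G] [SigmaCompactSpace G] [ChartedSpace E G] [Group G]
  [LieGroup 𝓘(ℝ, E) ∞ G] [PreconnectedSpace G] [Nontrivial G] [MeasurableSpace G]
  {δ : DilationFamily E G} {N : HomogeneousNorm δ} {π : ℝ → Set (Set G)} {q p : ℝ≥0∞}

theorem IsScaledPartitionFamily.countable (hπ : IsScaledPartitionFamily N π) {r : ℝ}
    (hr : 0 < r) : (π r).Countable := by
  have : IsTopologicalGroup G := topologicalGroup_of_lieGroup 𝓘(ℝ, E) ∞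
  have : ProperSpace E := FiniteDimensional.proper ℝ E
  have : SecondCountableTopology G := ChartedSpace.secondCountable_of_sigmaCompact E G
  have hγ := N.one_le_quasiConst
  exact (hπ r hr).countable (N.isOpen_ball_one _) ⟨1, N.one_mem_ball_one (by positivity)⟩

theorem fracAmalgamNorm_self_le_eLpNorm (μ : Measure G) (hπ : IsScaledPartitionFamily N π)
    (hq : 1 ≤ q) (hqp : q ≤ p) (f : G → ℂ) :
    fracAmalgamNorm N μ π q p q f ≤ eLpNorm f q μ := by
  rw [fracAmalgamNorm_self]
  exact iSup₂_le fun r hr => amalgamNorm_le_eLpNorm (hπ r hr).isPartition (hπ.countable hr)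
    (hπ r hr).measurableSet hq hqp f

theorem eLpNorm_le_mul_fracAmalgamNorm_self [BorelSpace G] (μ : Measure G) [μ.IsHaarMeasure]
    (hπ : IsScaledPartitionFamily N π) (hq : 1 ≤ q) (hqp : q ≤ p) (f : G → ℂ) :
    eLpNorm f q μ ≤
      ENNReal.ofReal ((4 * N.quasiConst ^ 4 + 3 * N.quasiConst ^ 2) ^ δ.homogeneousDim) ^
        ((q⁻¹).toReal - (p⁻¹).toReal) * fracAmalgamNorm N μ π q p q f := by
  have hγ := N.one_le_quasiConst
  rw [fracAmalgamNorm_self]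
  have hle : ∀ r : ℝ, 0 < r →
      amalgamNorm μ q p (π r) f ≤ ⨆ (r : ℝ) (_ : 0 < r), amalgamNorm μ q p (π r) f :=
    fun r hr => le_iSup₂ (f := fun r (_ : 0 < r) => amalgamNorm μ q p (π r) f) r hr
  by_cases hqt : q = ⊤
  · obtain rfl : p = ⊤ := top_le_iff.1 (hqt ▸ hqp)
    subst hqt
    simpa using (eLpNorm_top_le_amalgamNorm (hπ 1 one_pos).isPartition
      (hπ.countable one_pos) f).trans (hle 1 one_pos)
  have hexp : 0 ≤ (q⁻¹).toReal - (p⁻¹).toReal :=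
    sub_nonneg.2 (ENNReal.toReal_mono (by simpa using (zero_lt_one.trans_le hq).ne')
      (ENNReal.inv_le_inv.2 hqp))
  refine eLpNorm_le_of_forall_indicator_le hq hqt f (B := fun n : ℕ => N.ball 1 (n + 1))
    (fun n => (N.isOpen_ball_one _).measurableSet) ?_ ?_ fun n => ?_
  · intro m n hmn x hx
    rw [HomogeneousNorm.mem_ball_one] at hx ⊢
    exact hx.trans_le (by gcongr)
  · refine eq_univ_of_forall fun x => mem_iUnion.2 ?_
    obtain ⟨n, hn⟩ := exists_nat_gt (N.toFun x)
    exact ⟨n, N.mem_ball_one.2 (by linarith)⟩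
  · set R : ℝ := n + 1 with hR
    have hR0 : 0 < R := by positivity
    -- The scale `r = 4γ²R` is chosen so that `U_r` is exactly `B(e,R)`.
    have hr0 : 0 < 4 * N.quasiConst ^ 2 * R := by positivity
    have hP := hπ _ hr0
    rw [mul_div_cancel_left₀ R (by positivity : 4 * N.quasiConst ^ 2 ≠ 0)] at hP
    have hfin := N.finite_inter_ball_nonempty hR0 hP
    refine (eLpNorm_indicator_le_card_mul_amalgamNorm hP.isPartition hP.measurableSet hq hqt hqp f
      (N.isOpen_ball_one R).measurableSet hfin.toFinset
      (fun F hF => ((hfin.mem_toFinset).1 hF).1)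
      (fun F hF hFB => (hfin.mem_toFinset).2 ⟨hF, hFB⟩)).trans ?_
    gcongr
    · exact N.card_le_of_inter_ball_nonempty μ hR0 hP _ fun F hF => (hfin.mem_toFinset).1 hF
    · exact hle _ hr0

end Main

theorem mainTheorem9 {E G : Type*} [NormedAddCommGroup E] [NormedSpace ℝ E]
    [FiniteDimensional ℝ E] [TopologicalSpace G] [T2Space G] [SigmaCompactSpace G]
    [ChartedSpace E G] [Group G] [LieGroup 𝓘(ℝ, E) ∞ G]
    [SimplyConnectedSpace G] [Group.IsNilpotent G] [Nontrivial G]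
    [MeasurableSpace G] [BorelSpace G] (μ : Measure G) [μ.IsHaarMeasure]
    (δ : DilationFamily E G) (N : HomogeneousNorm δ)
    (π : ℝ → Set (Set G)) (hπ : IsScaledPartitionFamily N π)
    (q p : ℝ≥0∞) (hq : 1 ≤ q) (hqp : q ≤ p) :
    fracAmalgamSpace N μ π q p q = (Lp ℂ q μ : Set (G →ₘ[μ] ℂ)) ∧
    (p ≠ ⊤ → ∀ f : G →ₘ[μ] ℂ,
      fracAmalgamNorm N μ π q p q f ≤ eLpNorm f q μ ∧
      eLpNorm f q μ ≤
        ENNReal.ofReal ((4 * N.quasiConst ^ 4 + 3 * N.quasiConst ^ 2) ^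
          (δ.homogeneousDim * (p.toReal - q.toReal) / (p.toReal * q.toReal))) *
        fracAmalgamNorm N μ π q p q f) := by
  have hγ := N.one_le_quasiConst
  have hk : 0 < 4 * N.quasiConst ^ 4 + 3 * N.quasiConst ^ 2 := by positivity
  refine ⟨?_, fun hp f => ⟨fracAmalgamNorm_self_le_eLpNorm μ hπ hq hqp f, ?_⟩⟩
  · ext f
    rw [SetLike.mem_coe, Lp.mem_Lp_iff_eLpNorm_lt_top]
    refine ⟨fun hf => (eLpNorm_le_mul_fracAmalgamNorm_self μ hπ hq hqp f).trans_lt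
      (ENNReal.mul_lt_top ?_ hf),
      fun hf => (fracAmalgamNorm_self_le_eLpNorm μ hπ hq hqp f).trans_lt hf⟩
    -- The constant is finite also for `p = ∞`, where the exponent is `1/q`.
    rw [ENNReal.ofReal_rpow_of_pos (Real.rpow_pos_of_pos hk _)]
    exact ENNReal.ofReal_lt_top
  · refine (eLpNorm_le_mul_fracAmalgamNorm_self μ hπ hq hqp f).trans_eq ?_
    have hqt : q ≠ ⊤ := ne_top_of_le_ne_top hp hqp
    have hq0 : 0 < q.toReal := ENNReal.toReal_pos (zero_lt_one.trans_le hq).ne' hqt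
    have hp0 : 0 < p.toReal := hq0.trans_le (ENNReal.toReal_mono hp hqp)
    -- The exponent `ρ(1/q - 1/p)` is rewritten as `ρ(p - q)/(pq)`.
    rw [ENNReal.ofReal_rpow_of_pos (Real.rpow_pos_of_pos hk _), ← Real.rpow_mul hk.le,
      ENNReal.toReal_inv, ENNReal.toReal_inv]
    congr 3
    field_simp
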